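/- Let $\mathcal T_n$ be the set of rooted ordered (plane) trees with $n$ edges. The level of a node is its distance from the root, and $\mathrm{lev}(T,\ell)$ is the set of nodes of $T$ at level $\ell$. For a node $v$ of $T$ let $\mathrm{bfsScore}(v)$ and $\mathrm{dfsScore}(v)$ be the number of nodes visited before $v$ by breadth-first search and by depth-first search (pre-order), respectively, both started at the root and treating the children of every node from left to right. Put $$\mathrm{totalB}(n,\ell)=\sum_{T\in\mathcal T_n}\ \sum_{v\in\mathrm{lev}(T,\ell)}\mathrm{bfsScore}(v),\qquad \mathrm{totalD}(n,\ell)=\sum_{T\in\mathcal T_n}\ \sum_{v\in\mathrm{lev}(T,\ell)}\mathrm{dfsScore}(v).$$ Let $\Phi(x)=\frac1{\sqrt{2\pi}}\int_{-\infty}^x e^{-t^2/2}\,dt$, and let $\binom{N}{k}=0$ for $k<0$. **Theorem 3.1.** 1. For all integers $n\ge 0$ and $0\le \ell\le n$, $$\mathrm{totalB}(n,\ell)=\frac{n(2\ell+1)}{n+\ell+1}\binom{2n}{n-\ell}-\binom{2n}{n-2\ell-1}-2\sum_{j=\ell+1}^{2\ell}\binom{2n}{n-j}$$ $$=\mathrm{totalD}(n,\ell)+\mathrm{totalD}(n,\ell+1)-\binom{2n}{n-2\ell-1}-2\sum_{j=\ell+1}^{2\ell}\binom{2n}{n-j}.$$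 2. With $s=\ell/\sqrt n$, $$\frac{\mathrm{totalB}(n,\ell)}{4^n}=\frac{2s}{\sqrt\pi}e^{-s^2}-2\left(\Phi(2\sqrt2\,s)-\Phi(\sqrt2\,s)\right)+O\!\left(\frac1{\sqrt n}\right),$$ where the implied constant is absolute: it is the same for all $n\ge1$ and $0\le\ell\le n$. 3. Let $\varepsilon>0$, let $(\ell_n)$ be a sequence of integers with $0\le\ell_n\le n$, and suppose that $s_n=\ell_n/\sqrt n$ satisfies $n^\varepsilon=o(s_n)$ as $n\to\infty$. Then, for all sufficiently large $n$, $$\frac{\mathrm{totalB}(n,\ell_n)}{4^n}\le 2s_n\sqrt n\,e^{-n^{2\varepsilon}},$$ and $2s_n\sqrt n\,e^{-n^{2\varepsilon}}=o(e^{-n^\varepsilon})$ as $n\to\infty$; in particular $\mathrm{totalB}(n,\ell_n)/4^n=o(e^{-n^\varepsilon})$. -/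

import Mathlib

open Filter Asymptotics

/-- Unlabeled rooted ordered trees (plane trees): a root together with the ordered list of the
subtrees hanging from it. -/
inductive OrderedTree : Type where
  | node (children : List OrderedTree) : OrderedTree

namespace OrderedTree

/-- The ordered list of the subtrees rooted at the children of the root. -/
def children : OrderedTree → List OrderedTree
  | node ts => ts

mutual

/-- The number of edges of an ordered tree. -/
def numEdges : OrderedTree → ℕ
  | node ts => numEdgesBelow ts

/-- The number of edges of the tree whose root has the listed subtrees: every subtree contributes
its own edges and the edge that joins it to the root. -/
def numEdgesBelow : List OrderedTree → ℕ
  | [] => 0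
  | t :: ts => (numEdges t + 1) + numEdgesBelow ts

end

/-- The size of a queue of subtrees, in nodes (a tree has one node more than edges). -/
def queueSize {α : Type} (q : List (α × OrderedTree)) : ℕ :=
  (q.map fun p => p.2.numEdges + 1).sum

/- A node of a tree is named by its address: the list of the (zero-based) child indices on the path
from the root to it. The root is `[]`, and the level of a node is the length of its address. -/

mutual

/-- The nodes of a tree in the order in which depth-first search visits them: first the root, then
recursively the subtrees from left to right. Every node is listed exactly once. -/
def dfsOrder : OrderedTree → List (List ℕ)
  | node ts => [] :: dfsOrderBelow 0 ts

/-- The nodes of the listed subtrees, in depth-first order, where the subtrees are those of the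
children number `i`, `i + 1`, … of a common parent. -/
def dfsOrderBelow : ℕ → List OrderedTree → List (List ℕ)
  | _, [] => []
  | i, t :: ts => (dfsOrder t).map (fun v => i :: v) ++ dfsOrderBelow (i + 1) ts

end

/-- The children of the node with address `v`, from left to right, each with the subtree rooted at
it, where `T` is the subtree rooted at `v`. -/
def childrenAt (v : List ℕ) (T : OrderedTree) : List (List ℕ × OrderedTree) :=
  T.children.mapIdx fun i t => (v ++ [i], t)

theorem queueSize_append {α : Type} (q r : List (α × OrderedTree)) :
    queueSize (q ++ r) = queueSize q + queueSize r := by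
  simp [queueSize]

theorem queueSize_childrenAt (v : List ℕ) (T : OrderedTree) :
    queueSize (childrenAt v T) = T.numEdges := by
  obtain ⟨ts⟩ := T
  have key : ∀ (ts : List OrderedTree) (f : ℕ → List ℕ),
      queueSize (ts.mapIdx fun i t => (f i, t)) = numEdgesBelow ts := by
    intro ts
    induction ts with
    | nil => intro f; simp [queueSize, numEdgesBelow]
    | cons t ts ih =>
      intro f
      have h := ih (fun i => f (i + 1))
      simp only [queueSize] at h
      simp only [queueSize, List.mapIdx_cons, List.map_cons, List.sum_cons, numEdgesBelow, h]
  simpa [childrenAt, children, numEdges] using key ts (fun i => v ++ [i])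

/-- Breadth-first search: take the first node of the queue, visit it, and put its children, from
left to right, at the end of the queue. The result is the list of the visited nodes in the order in
which they are visited. -/
def bfsQueue : List (List ℕ × OrderedTree) → List (List ℕ)
  | [] => []
  | (v, T) :: q => v :: bfsQueue (q ++ childrenAt v T)
termination_by q => queueSize q
decreasing_by
  rw [queueSize_append, queueSize_childrenAt]
  simp only [queueSize, List.map_cons, List.sum_cons]
  omega

/-- The nodes of a tree in the order in which breadth-first search from the root visits them. -/
def bfsOrder (T : OrderedTree) : List (List ℕ) :=
  bfsQueue [([], T)]

/-- The number of nodes visited before `v` when using breadth-first search. -/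
def bfsScore (T : OrderedTree) (v : List ℕ) : ℕ :=
  T.bfsOrder.idxOf v

/-- The number of nodes visited before `v` when using depth-first search. -/
def dfsScore (T : OrderedTree) (v : List ℕ) : ℕ :=
  T.dfsOrder.idxOf v

/-- The set of the nodes at level `l`. -/
def lev (T : OrderedTree) (l : ℕ) : Finset (List ℕ) :=
  T.dfsOrder.toFinset.filter fun v => v.length = l

theorem finite_numEdgesBelow_eq (n : ℕ) : {ts : List OrderedTree | numEdgesBelow ts = n}.Finite := by
  induction n using Nat.strong_induction_on with
  | _ n ih =>
    have hfin : (⋃ i ∈ Set.Iio n, {ts : List OrderedTree | numEdgesBelow ts = i}).Finite :=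
      (Set.finite_Iio n).biUnion fun i hi => ih i hi
    set F := ⋃ i ∈ Set.Iio n, {ts : List OrderedTree | numEdgesBelow ts = i} with hF
    refine ((Set.finite_singleton []).union
      (Set.Finite.image2 (fun us ts => node us :: ts) hfin hfin)).subset ?_
    rintro (_ | ⟨⟨us⟩, ts⟩) h
    · exact Or.inl rfl
    · right
      simp only [Set.mem_ofPred_eq, numEdgesBelow, numEdges] at h
      refine ⟨us, ?_, ts, ?_, rfl⟩ <;>
        simp only [hF, Set.mem_iUnion, Set.mem_ofPred_eq, Set.mem_Iio, exists_prop] <;>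
        exact ⟨_, by omega, rfl⟩

theorem finite_numEdges_eq (n : ℕ) : {T : OrderedTree | T.numEdges = n}.Finite := by
  refine ((finite_numEdgesBelow_eq n).image node).subset ?_
  rintro ⟨ts⟩ h
  exact ⟨ts, by simpa [numEdges] using h, rfl⟩

/-- The set of the ordered trees with exactly `n` edges. -/
noncomputable def treesWithEdges (n : ℕ) : Finset OrderedTree :=
  (finite_numEdges_eq n).toFinset

end OrderedTree

/-- The sum of the breadth-first scores of all nodes at level `l` in all ordered trees with `n`
edges. -/
noncomputable def totalB (n l : ℕ) : ℕ :=
  ∑ T ∈ OrderedTree.treesWithEdges n, ∑ v ∈ T.lev l, T.bfsScore v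

/-- The sum of the depth-first scores of all nodes at level `l` in all ordered trees with `n`
edges. -/
noncomputable def totalD (n l : ℕ) : ℕ :=
  ∑ T ∈ OrderedTree.treesWithEdges n, ∑ v ∈ T.lev l, T.dfsScore v

/-- The binomial coefficient `N` over `k` for an integer `k`; it is zero for negative `k`. -/
def binom (N : ℕ) (k : ℤ) : ℕ :=
  if 0 ≤ k then N.choose k.toNat else 0

/-- The cumulative distribution function of the standard normal distribution. -/
noncomputable def stdNormalCDF (s : ℝ) : ℝ :=
  1 / √(2 * Real.pi) * ∫ x in Set.Iic s, Real.exp (-x ^ 2 / 2)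

-- Breadth-first search visits the levels in order, so in a tree with level sizes `c k` the scores
-- on level `l` sum to `c l * ∑ k < l, c k + (c l).choose 2` (`sum_bfsScore`). The exact formula
-- thus needs only the sums of `c k * c l` over all trees.
--
-- These come from splitting a tree into its leftmost subtree `t` and the rest `T`. Level sizes,
-- products of level sizes and depth-first totals then all satisfy a linear equation `F = X * (H + C
-- * F)`, where the tree series `C` obeys `C = 1 + X * C ^ 2`; its solution is `X * C * H`. Level
-- `l` has series `X ^ l * C ^ (2 * l + 1)`, whose coefficients are differences of neighbouring
-- binomials (`coeff_levSeries`), so the sums of products telescope (`sum_levCard_mul`). The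
-- depth-first total is `l` times one binomial (`genFun_dfsTotal`).
--
-- For the asymptotics, the ratios of consecutive binomials have the form `(1 - x) / (1 + x)`, close
-- to `exp (-2 * x)`; multiplying them and using Wallis' product at the centre gives a Gaussian with
-- error `O(1 / (√n * (n + j ^ 2)))` (`abs_walkProb_sub_bell_le`). This decay in `j` survives both
-- the factor `2 * l` and a sum of `l` terms, so the constant is uniform in `l`. For large levels
-- the subtracted terms are dropped and a Gaussian tail bound suffices.

namespace List

-- Positions in lists.

/-- The sum of the (zero-based) positions of the entries of a list that satisfy `p`. -/
def posSum {α : Type*} (p : α → Bool) : List α → ℕ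
  | [] => 0
  | _ :: L => posSum p L + L.countP p

theorem posSum_append {α : Type*} (p : α → Bool) (L M : List α) :
    posSum p (L ++ M) = posSum p L + posSum p M + L.length * M.countP p := by
  induction L with
  | nil => simp [posSum]
  | cons a L ih => simp only [cons_append, posSum, ih, countP_append, length_cons]; ring

theorem posSum_map {α β : Type*} (p : β → Bool) (f : α → β) (L : List α) :
    posSum p (L.map f) = posSum (p ∘ f) L := by
  induction L with
  | nil => rfl
  | cons a L ih => simp only [map_cons, posSum, ih, countP_map]

theorem Nodup.card_filter_toFinset {α : Type*} [DecidableEq α] {L : List α} (h : L.Nodup)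
    (p : α → Prop) [DecidablePred p] :
    (L.toFinset.filter p).card = L.countP (fun a => decide (p a)) := by
  have h1 : L.toFinset.filter p = (L.filter fun a => decide (p a)).toFinset := by ext a; simp
  rw [countP_eq_length_filter, h1, toFinset_card_of_nodup (h.filter _)]

theorem Nodup.sum_idxOf {α : Type*} [DecidableEq α] [BEq α] [LawfulBEq α] {L : List α} (h : L.Nodup)
    (p : α → Prop) [DecidablePred p] :
    ∑ v ∈ L.toFinset.filter p, L.idxOf v = posSum (fun a => decide (p a)) L := by
  induction L with
  | nil => simp [posSum]
  | cons a L ih =>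
    obtain ⟨ha, hL⟩ := nodup_cons.1 h
    have ha' : a ∉ L.toFinset.filter p := by simp [ha]
    have key : ∑ v ∈ L.toFinset.filter p, (a :: L).idxOf v
        = ∑ v ∈ L.toFinset.filter p, L.idxOf v + L.countP (fun a => decide (p a)) := by
      rw [← hL.card_filter_toFinset p, Finset.card_eq_sum_ones, ← Finset.sum_add_distrib]
      refine Finset.sum_congr rfl fun v hv => ?_
      rw [idxOf_cons_ne _ (fun e : a = v => ha' (by rw [e]; exact hv))]
    rw [toFinset_cons, Finset.filter_insert, posSum, ← ih hL, ← key]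
    split_ifs
    · rw [Finset.sum_insert ha', idxOf_cons_self, zero_add]
    · rfl

/-- In a list sorted by `f`, the entries of value `l` occupy consecutive positions. -/
theorem posSum_of_sorted {α : Type*} (f : α → ℕ) (l : ℕ) {L : List α}
    (h : L.Pairwise fun a b => f a ≤ f b) :
    posSum (fun a => decide (f a = l)) L
      = L.countP (fun a => decide (f a = l)) * L.countP (fun a => decide (f a < l))
        + (L.countP (fun a => decide (f a = l))).choose 2 := by
  induction L with
  | nil => simp [posSum]
  | cons a L ih =>
    obtain ⟨ha, hL⟩ := pairwise_cons.1 h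
    rw [posSum, ih hL, countP_cons, countP_cons]
    rcases lt_trichotomy (f a) l with h1 | h1 | h1
    · simp only [h1, h1.ne, decide_true, decide_false, if_true]
      simp; ring
    -- By sortedness nothing after a head of value `l` is smaller, so only the `choose 2` term
    -- grows.
    · have h0 : L.countP (fun a => decide (f a < l)) = 0 := by
        rw [countP_eq_zero]; intro b hb; have := ha b hb; simp; omega
      rw [h0]
      simp [h1, Nat.choose_succ_succ]; omega
    · have h0 : L.countP (fun a => decide (f a = l)) = 0 := by
        rw [countP_eq_zero]; intro b hb; have := ha b hb; simp; omega
      rw [h0]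
      simp [h1.ne']

end List

-- Level sizes and depth-first totals of a single tree.

namespace OrderedTree

/-- The tree obtained by adding `t` as a new leftmost subtree of the root of `T`. -/
def cons (t T : OrderedTree) : OrderedTree := node (t :: T.children)

theorem nil_notMem_dfsOrderBelow (i : ℕ) (ts : List OrderedTree) : [] ∉ dfsOrderBelow i ts := by
  induction ts generalizing i with
  | nil => simp [dfsOrderBelow]
  | cons t ts ih => simp [dfsOrderBelow, ih]

theorem le_head_of_mem_dfsOrderBelow {i j : ℕ} {v : List ℕ} {ts : List OrderedTree}
    (h : j :: v ∈ dfsOrderBelow i ts) : i ≤ j := by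
  induction ts generalizing i with
  | nil => simp [dfsOrderBelow] at h
  | cons t ts ih =>
    simp only [dfsOrderBelow, List.mem_append, List.mem_map, List.cons.injEq] at h
    rcases h with ⟨_, _, h, _⟩ | h
    · exact h.le
    · exact (Nat.le_succ i).trans (ih h)

mutual

theorem nodup_dfsOrder : ∀ T : OrderedTree, T.dfsOrder.Nodup
  | node ts => by
    rw [dfsOrder, List.nodup_cons]
    exact ⟨nil_notMem_dfsOrderBelow 0 ts, nodup_dfsOrderBelow 0 ts⟩

theorem nodup_dfsOrderBelow : ∀ (i : ℕ) (ts : List OrderedTree), (dfsOrderBelow i ts).Nodup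
  | _, [] => by simp [dfsOrderBelow]
  | i, t :: ts => by
    rw [dfsOrderBelow, List.nodup_append']
    refine ⟨(nodup_dfsOrder t).map (List.cons_injective), nodup_dfsOrderBelow (i + 1) ts, ?_⟩
    intro w hw hw'
    obtain ⟨v, _, rfl⟩ := List.mem_map.1 hw
    have := le_head_of_mem_dfsOrderBelow hw'
    omega

end

theorem map_length_dfsOrderBelow (i j : ℕ) (ts : List OrderedTree) :
    (dfsOrderBelow i ts).map List.length = (dfsOrderBelow j ts).map List.length := by
  induction ts generalizing i j with
  | nil => rfl
  | cons t ts ih =>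
    simp only [dfsOrderBelow, List.map_append, List.map_map, ih (i + 1) (j + 1)]
    rfl

mutual

theorem length_dfsOrder : ∀ T : OrderedTree, T.dfsOrder.length = T.numEdges + 1
  | node ts => by rw [dfsOrder, numEdges, List.length_cons, length_dfsOrderBelow 0 ts]

theorem length_dfsOrderBelow : ∀ (i : ℕ) (ts : List OrderedTree),
    (dfsOrderBelow i ts).length = numEdgesBelow ts
  | _, [] => by simp [dfsOrderBelow, numEdgesBelow]
  | i, t :: ts => by
    rw [dfsOrderBelow, List.length_append, List.length_map, length_dfsOrder t,
      length_dfsOrderBelow (i + 1) ts, numEdgesBelow]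

end

/-- The number of nodes at level `l`. -/
def levCard (T : OrderedTree) (l : ℕ) : ℕ :=
  (T.dfsOrder.map List.length).countP (fun k => decide (k = l))

/-- The sum of the depth-first scores of the nodes at level `l`. -/
def dfsTotal (T : OrderedTree) (l : ℕ) : ℕ :=
  (T.dfsOrder.map List.length).posSum (fun k => decide (k = l))

theorem sum_dfsScore (T : OrderedTree) (l : ℕ) : ∑ v ∈ T.lev l, T.dfsScore v = T.dfsTotal l := by
  rw [dfsTotal, List.posSum_map]
  exact (nodup_dfsOrder T).sum_idxOf (fun v => v.length = l)

/-- Pre-order visits the root, then `t` one level deeper, then what `T` has besides its root. -/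
theorem map_length_dfsOrder_cons (t T : OrderedTree) :
    ((cons t T).dfsOrder).map List.length
      = 0 :: ((t.dfsOrder.map List.length).map (· + 1) ++ (T.dfsOrder.map List.length).tail) := by
  obtain ⟨ts⟩ := T
  simp only [cons, children, dfsOrder, dfsOrderBelow, List.map_cons, List.map_append,
    List.tail_cons, map_length_dfsOrderBelow (0 + 1) 0 ts, List.length_nil, List.map_map]
  rfl

theorem map_length_dfsOrder_eq (T : OrderedTree) :
    T.dfsOrder.map List.length = 0 :: (T.dfsOrder.map List.length).tail := by
  obtain ⟨ts⟩ := T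
  simp [dfsOrder]

theorem zero_notMem_tail (T : OrderedTree) : 0 ∉ (T.dfsOrder.map List.length).tail := by
  obtain ⟨ts⟩ := T
  simp [dfsOrder, nil_notMem_dfsOrderBelow]

theorem levCard_zero (T : OrderedTree) : T.levCard 0 = 1 := by
  rw [levCard, map_length_dfsOrder_eq, List.countP_cons, List.countP_eq_zero.2]
  · simp
  · intro k hk h
    exact zero_notMem_tail T (of_decide_eq_true h ▸ hk)

theorem levCard_leaf (l : ℕ) : (node []).levCard (l + 1) = 0 := by
  simp [levCard, dfsOrder, dfsOrderBelow]

theorem countP_map_succ (l : ℕ) (L : List ℕ) :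
    (L.map (· + 1)).countP (fun k => decide (k = l + 1)) = L.countP (fun k => decide (k = l)) := by
  rw [List.countP_map]; congr 1; ext k; simp

theorem levCard_succ_eq_tail (T : OrderedTree) (l : ℕ) :
    T.levCard (l + 1)
      = (T.dfsOrder.map List.length).tail.countP (fun k => decide (k = l + 1)) := by
  rw [levCard, map_length_dfsOrder_eq, List.countP_cons]; simp

theorem levCard_cons (t T : OrderedTree) (l : ℕ) :
    (cons t T).levCard (l + 1) = t.levCard l + T.levCard (l + 1) := by
  rw [levCard, map_length_dfsOrder_cons, List.countP_cons, List.countP_append, countP_map_succ,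
    levCard_succ_eq_tail T, levCard]
  simp

theorem dfsTotal_zero (T : OrderedTree) : T.dfsTotal 0 = 0 := by
  have h := fun k hk h => zero_notMem_tail T ((of_decide_eq_true h : k = 0) ▸ hk)
  rw [dfsTotal, map_length_dfsOrder_eq, List.posSum, List.countP_eq_zero.2 h, add_zero]
  generalize (T.dfsOrder.map List.length).tail = L at h
  induction L with
  | nil => rfl
  | cons a L ih =>
    have h' : ∀ k ∈ L, ¬ decide (k = 0) = true := fun k hk => h k (List.mem_cons_of_mem _ hk)
    rw [List.posSum, ih h', List.countP_eq_zero.2 h']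

theorem dfsTotal_leaf (l : ℕ) : (node []).dfsTotal l = 0 := by
  simp [dfsTotal, dfsOrder, dfsOrderBelow, List.posSum]

/-- Nodes of `t` gain one predecessor, the new root. Nodes of `T` already count a root and gain all
`t.numEdges + 1` nodes of `t`. -/
theorem dfsTotal_cons (t T : OrderedTree) (l : ℕ) :
    (cons t T).dfsTotal (l + 1) = t.dfsTotal l + t.levCard l + T.dfsTotal (l + 1)
      + (t.numEdges + 1) * T.levCard (l + 1) := by
  have h1 : (fun k => decide (k = l + 1)) ∘ (fun k => k + 1) = fun k => decide (k = l) := by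
    ext k; simp
  have h2 : T.dfsTotal (l + 1)
      = (T.dfsOrder.map List.length).tail.posSum (fun k => decide (k = l + 1))
        + T.levCard (l + 1) := by
    rw [levCard_succ_eq_tail, dfsTotal, map_length_dfsOrder_eq, List.posSum]; simp
  rw [h2, dfsTotal, map_length_dfsOrder_cons, List.posSum, List.countP_append, countP_map_succ,
    ← levCard_succ_eq_tail T, List.posSum_append, List.posSum_map _ (fun k => k + 1), h1,
    ← levCard_succ_eq_tail T, ← levCard, ← dfsTotal, List.length_map, List.length_map,
    length_dfsOrder]
  ring

-- Breadth-first search order.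

theorem map_append_dfsOrderBelow (v : List ℕ) (i : ℕ) (ts : List OrderedTree) :
    (dfsOrderBelow i ts).map (v ++ ·)
      = (ts.mapIdx fun j t => (v ++ [i + j], t)).flatMap
          fun p => p.2.dfsOrder.map (p.1 ++ ·) := by
  induction ts generalizing i with
  | nil => simp [dfsOrderBelow]
  | cons t ts ih =>
    rw [dfsOrderBelow, List.map_append, ih, List.mapIdx_cons, List.flatMap_cons, List.map_map]
    congr 1
    · simp [Function.comp_def]
    · simp only [add_assoc, add_comm 1]

theorem map_append_dfsOrder (v : List ℕ) (T : OrderedTree) :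
    T.dfsOrder.map (v ++ ·)
      = v :: (childrenAt v T).flatMap fun p => p.2.dfsOrder.map (p.1 ++ ·) := by
  obtain ⟨ts⟩ := T
  simp [dfsOrder, childrenAt, children, map_append_dfsOrderBelow]

theorem bfsQueue_perm (q : List (List ℕ × OrderedTree)) :
    (bfsQueue q).Perm (q.flatMap fun p => p.2.dfsOrder.map (p.1 ++ ·)) := by
  induction q using bfsQueue.induct with
  | case1 => simp [bfsQueue]
  | case2 v T q ih =>
    rw [bfsQueue, List.flatMap_cons, map_append_dfsOrder, List.cons_append]
    refine List.Perm.cons _ (ih.trans ?_)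
    rw [List.flatMap_append]
    exact List.perm_append_comm

theorem bfsOrder_perm (T : OrderedTree) : T.bfsOrder.Perm T.dfsOrder := by
  have := bfsQueue_perm [([], T)]
  simpa [bfsOrder] using this

/-- The queue invariant: levels are nondecreasing along the queue and differ by at most one, so
children of the head may be appended at the end. -/
theorem bfsQueue_pairwise (q : List (List ℕ × OrderedTree))
    (h : q.Pairwise fun a b => a.1.length ≤ b.1.length)
    (h' : ∀ a ∈ q, ∀ b ∈ q, b.1.length ≤ a.1.length + 1) :
    (bfsQueue q).Pairwise fun v w => v.length ≤ w.length := by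
  induction q using bfsQueue.induct with
  | case1 => simp [bfsQueue]
  | case2 v T q ih =>
    obtain ⟨hv, hq⟩ := List.pairwise_cons.1 h
    have hc : ∀ p ∈ childrenAt v T, p.1.length = v.length + 1 := by
      intro p hp
      obtain ⟨i, hi, rfl⟩ := List.mem_mapIdx.1 hp
      simp
    have hup : ∀ p ∈ q, p.1.length ≤ v.length + 1 := fun p hp =>
      h' (v, T) List.mem_cons_self p (List.mem_cons_of_mem _ hp)
    rw [bfsQueue, List.pairwise_cons]
    constructor
    · intro w hw
      have := (bfsQueue_perm _).mem_iff.1 hw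
      obtain ⟨p, hp, hw⟩ := List.mem_flatMap.1 this
      obtain ⟨u, _, rfl⟩ := List.mem_map.1 hw
      rw [List.length_append]
      rcases List.mem_append.1 hp with hp | hp
      · have := hv p hp; simp only at this; omega
      · have := hc p hp; omega
    · apply ih
      · rw [List.pairwise_append]
        refine ⟨hq, ?_, fun a ha b hb => ?_⟩
        · exact List.pairwise_of_forall_mem_list fun a ha b hb => by rw [hc a ha, hc b hb]
        · rw [hc b hb]; exact hup a ha
      · intro a ha b hb
        rcases List.mem_append.1 ha with ha | ha <;> rcases List.mem_append.1 hb with hb | hb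
        · have := hv a ha; have := hup b hb; simp only at *; omega
        · have := hv a ha; have := hc b hb; simp only at *; omega
        · have := hc a ha; have := hup b hb; omega
        · rw [hc a ha, hc b hb]; omega

theorem countP_length_lt (L : List (List ℕ)) (l : ℕ) :
    L.countP (fun v => decide (v.length < l))
      = ∑ k ∈ Finset.range l, L.countP (fun v => decide (v.length = k)) := by
  induction L with
  | nil => simp
  | cons a L ih =>
    simp only [List.countP_cons, ih, Finset.sum_add_distrib, decide_eq_true_eq,
      Finset.sum_ite_eq, Finset.mem_range]

theorem sum_bfsScore (T : OrderedTree) (l : ℕ) :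
    ∑ v ∈ T.lev l, T.bfsScore v
      = T.levCard l * ∑ k ∈ Finset.range l, T.levCard k + (T.levCard l).choose 2 := by
  have hp := bfsOrder_perm T
  have hcount : ∀ k, T.bfsOrder.countP (fun v => decide (v.length = k)) = T.levCard k := fun k => by
    rw [hp.countP_eq, levCard, List.countP_map]; rfl
  have h1 := (hp.nodup_iff.2 (nodup_dfsOrder T)).sum_idxOf (fun v => v.length = l)
  have h2 : T.bfsOrder.Pairwise fun v w => v.length ≤ w.length :=
    bfsQueue_pairwise _ (by simp) (by simp)
  rw [List.posSum_of_sorted List.length l h2, countP_length_lt, hcount] at h1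
  simp only [hcount] at h1
  rw [← h1, lev, List.toFinset_eq_of_perm _ _ hp]
  rfl

end OrderedTree

-- Generating functions from the leftmost-subtree decomposition.

namespace OrderedTree

open PowerSeries

theorem mem_treesWithEdges {n : ℕ} {T : OrderedTree} : T ∈ treesWithEdges n ↔ T.numEdges = n := by
  simp [treesWithEdges]

theorem numEdges_cons (t T : OrderedTree) :
    (cons t T).numEdges = t.numEdges + T.numEdges + 1 := by
  obtain ⟨ts⟩ := T
  simp only [cons, children, numEdges, numEdgesBelow]; ring

theorem cons_inj {t t' T T' : OrderedTree} (h : cons t T = cons t' T') : t = t' ∧ T = T' := by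
  obtain ⟨ts⟩ := T
  obtain ⟨ts'⟩ := T'
  simpa [cons, children] using h

theorem treesWithEdges_zero : treesWithEdges 0 = {node []} := by
  ext ⟨ts⟩
  cases ts <;> simp [mem_treesWithEdges, numEdges, numEdgesBelow]

theorem sum_treesWithEdges_succ (f : OrderedTree → ℝ) (n : ℕ) :
    ∑ T ∈ treesWithEdges (n + 1), f T
      = ∑ p ∈ Finset.HasAntidiagonal.antidiagonal n, ∑ t ∈ treesWithEdges p.1, ∑ T ∈ treesWithEdges p.2,
          f (cons t T) := by
  simp_rw [← Finset.sum_product']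
  rw [Finset.sum_sigma']
  symm
  refine Finset.sum_bij (fun x _ => cons x.2.1 x.2.2) ?_ ?_ ?_ (fun _ _ => rfl)
  · rintro ⟨p, t, T⟩ h
    simp only [Finset.mem_sigma, Finset.HasAntidiagonal.mem_antidiagonal, Finset.mem_product,
      mem_treesWithEdges] at h ⊢
    rw [numEdges_cons]; omega
  · rintro ⟨⟨a, b⟩, t, T⟩ h ⟨⟨a', b'⟩, t', T'⟩ h' e
    simp only [Finset.mem_sigma, Finset.HasAntidiagonal.mem_antidiagonal, Finset.mem_product,
      mem_treesWithEdges] at h h'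
    obtain ⟨rfl, rfl⟩ := cons_inj e
    obtain ⟨_, rfl, rfl⟩ := h
    obtain ⟨_, rfl, rfl⟩ := h'
    rfl
  · rintro ⟨ts⟩ h
    rw [mem_treesWithEdges] at h
    cases ts with
    | nil => simp [numEdges, numEdgesBelow] at h
    | cons t ts =>
      refine ⟨⟨(t.numEdges, (node ts).numEdges), t, node ts⟩, ?_, rfl⟩
      simp only [numEdges, numEdgesBelow, Finset.mem_sigma, Finset.HasAntidiagonal.mem_antidiagonal,
        Finset.mem_product, mem_treesWithEdges, and_self, and_true] at h ⊢
      omega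

/-- The generating function of a statistic on ordered trees. -/
noncomputable def genFun (f : OrderedTree → ℝ) : ℝ⟦X⟧ :=
  PowerSeries.mk fun n => ∑ T ∈ treesWithEdges n, f T

/-- The generating function of ordered trees by the number of edges. -/
noncomputable def treeSeries : ℝ⟦X⟧ := genFun fun _ => 1

/-- The generating function of a statistic on pairs of ordered trees. -/
noncomputable def genFunPair (f : OrderedTree → OrderedTree → ℝ) : ℝ⟦X⟧ :=
  PowerSeries.mk fun n => ∑ p ∈ Finset.HasAntidiagonal.antidiagonal n,
    ∑ t ∈ treesWithEdges p.1, ∑ T ∈ treesWithEdges p.2, f t T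

theorem genFunPair_add (f g : OrderedTree → OrderedTree → ℝ) :
    genFunPair (fun t T => f t T + g t T) = genFunPair f + genFunPair g := by
  ext n; simp [genFunPair, Finset.sum_add_distrib]

theorem genFunPair_mul (f g : OrderedTree → ℝ) :
    genFunPair (fun t T => f t * g T) = genFun f * genFun g := by
  ext n; simp [genFunPair, genFun, coeff_mul, Finset.sum_mul_sum]

theorem genFunPair_left (f : OrderedTree → ℝ) :
    genFunPair (fun t _ => f t) = genFun f * treeSeries := by
  rw [treeSeries, ← genFunPair_mul]; simp

theorem genFunPair_right (f : OrderedTree → ℝ) :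
    genFunPair (fun _ T => f T) = treeSeries * genFun f := by
  rw [treeSeries, ← genFunPair_mul]; simp

theorem genFun_eq (f : OrderedTree → ℝ) :
    genFun f = C (f (node [])) + X * genFunPair fun t T => f (cons t T) := by
  ext n
  cases n with
  | zero => simp [genFun, treesWithEdges_zero]
  | succ n =>
    rw [map_add, coeff_succ_X_mul, coeff_C, if_neg n.succ_ne_zero, zero_add]
    simp [genFun, genFunPair, sum_treesWithEdges_succ]

theorem treeSeries_eq : treeSeries = 1 + X * treeSeries ^ 2 := by
  have := genFun_eq fun _ => 1
  rw [genFunPair_left (fun _ => 1)] at this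
  rw [pow_two]
  simpa [← treeSeries.eq_1] using this

/-- The generating function of the number of nodes at level `l`. -/
noncomputable def levSeries (l : ℕ) : ℝ⟦X⟧ := X ^ l * treeSeries ^ (2 * l + 1)

/-- Solves the linear equation met when only the leftmost subtree of the root is descended into. -/
theorem eq_of_eq_X_mul {F H : ℝ⟦X⟧} (h : F = X * (H + treeSeries * F)) :
    F = X * treeSeries * H := by
  have hC := treeSeries_eq
  -- The tree equation says that `treeSeries` is the inverse of `1 - X * treeSeries`.
  linear_combination treeSeries * h - F * hC

theorem genFun_levCard (l : ℕ) : genFun (fun T => (T.levCard l : ℝ)) = levSeries l := by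
  induction l with
  | zero => simp [levCard_zero, levSeries, treeSeries]
  | succ l ih =>
    have h := genFun_eq fun T => (T.levCard (l + 1) : ℝ)
    simp only [levCard_leaf, levCard_cons, Nat.cast_add, genFunPair_add, genFunPair_left,
      genFunPair_right, Nat.cast_zero, map_zero, zero_add] at h
    rw [eq_of_eq_X_mul h, ih]
    simp only [levSeries]; ring

/-- Going from `k` to `k + 1`, the terms inside `t` are multiplied by `X * treeSeries ^ 2`, which
raises each index of `levSeries` by one. The two cross terms both become `levSeries (2 * k + m +
2)`, hence the factor 2 and the new last summand. -/
theorem genFun_levCard_mul (k m : ℕ) :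
    genFun (fun T => (T.levCard k : ℝ) * T.levCard (k + m))
      = levSeries (k + m)
        + 2 * ∑ p ∈ Finset.range k, levSeries (k + m + 1 + p) := by
  induction k with
  | zero => simp [levCard_zero, genFun_levCard]
  | succ k ih =>
    have h := genFun_eq fun T => (T.levCard (k + 1) : ℝ) * T.levCard (k + m + 1)
    have e : ∀ t T : OrderedTree, ((cons t T).levCard (k + 1) : ℝ) * (cons t T).levCard (k + m + 1)
        = ((t.levCard k : ℝ) * t.levCard (k + m) + t.levCard k * T.levCard (k + m + 1)
          + t.levCard (k + m) * T.levCard (k + 1)) + T.levCard (k + 1) * T.levCard (k + m + 1) := by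
      intro t T; rw [levCard_cons, levCard_cons]; push_cast; ring
    simp only [e] at h
    rw [genFunPair_add, genFunPair_add, genFunPair_add, genFunPair_mul, genFunPair_mul,
      genFunPair_left (fun t => (t.levCard k : ℝ) * t.levCard (k + m)),
      genFunPair_right (fun T => (T.levCard (k + 1) : ℝ) * T.levCard (k + m + 1)), ih,
      levCard_leaf, Nat.cast_zero, zero_mul, map_zero, zero_add] at h
    simp only [genFun_levCard] at h
    rw [show k + 1 + m = k + m + 1 by ring, eq_of_eq_X_mul h, Finset.sum_range_succ]
    have e2 : ∀ p, levSeries (k + m + 1 + 1 + p)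
        = X * treeSeries ^ 2 * levSeries (k + m + 1 + p) := fun p => by
      simp only [levSeries]; ring
    simp only [e2, ← Finset.mul_sum]
    generalize ∑ p ∈ Finset.range k, levSeries (k + m + 1 + p) = S
    simp only [levSeries]
    ring

-- Binomial coefficients as coefficients of the level series.

/-- The binomial coefficient `2n` over `n - j`. -/
def centralShift (n : ℕ) (j : ℤ) : ℝ := (binom (2 * n) (n - j) : ℝ)

theorem binom_succ (N : ℕ) (k : ℤ) : binom (N + 1) k = binom N k + binom N (k - 1) := by
  rcases lt_trichotomy k 0 with h | rfl | h
  · rw [binom, binom, binom, if_neg (by omega), if_neg (by omega), if_neg (by omega)]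
  · simp [binom]
  · obtain ⟨m, rfl⟩ : ∃ m : ℕ, k = m + 1 := ⟨(k - 1).toNat, by omega⟩
    rw [binom, binom, binom, if_pos (by omega), if_pos (by omega), if_pos (by omega)]
    have h1 : ((m : ℤ) + 1).toNat = m + 1 := by omega
    have h2 : ((m : ℤ) + 1 - 1).toNat = m := by omega
    rw [h1, h2, Nat.choose_succ_succ, add_comm]

theorem centralShift_succ (n : ℕ) (j : ℤ) :
    centralShift (n + 1) j
      = centralShift n (j - 1) + 2 * centralShift n j + centralShift n (j + 1) := by
  simp only [centralShift]
  rw [show 2 * (n + 1) = 2 * n + 1 + 1 by ring, binom_succ, binom_succ, binom_succ]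
  push_cast
  rw [show (n : ℤ) + 1 - j = n - (j - 1) by ring, show (n : ℤ) - (j - 1) - 1 = n - j by ring,
    show (n : ℤ) - j - 1 = n - (j + 1) by ring]
  ring

theorem centralShift_of_le {n : ℕ} {j : ℕ} (h : j ≤ n) :
    centralShift n j = ((2 * n).choose (n - j) : ℝ) := by
  rw [centralShift, binom, if_pos (by omega), show ((n : ℤ) - j).toNat = n - j by omega]

theorem centralShift_of_lt {n : ℕ} {j : ℤ} (h : n < j) : centralShift n j = 0 := by
  rw [centralShift, binom, if_neg (by omega)]; simp

theorem centralShift_neg_one (n : ℕ) : centralShift n (-1) = centralShift n 1 := by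
  cases n with
  | zero => simp [centralShift, binom]
  | succ n =>
    rw [centralShift, centralShift, binom, binom, if_pos (by omega), if_pos (by omega)]
    congr 1
    apply Nat.choose_symm_of_eq_add
    omega

theorem centralShift_step (n l : ℕ) :
    ((n : ℝ) + l + 1) * centralShift n (l + 1) = ((n : ℝ) - l) * centralShift n l := by
  rcases lt_trichotomy l n with h | rfl | h
  · have h1 := centralShift_of_le (n := n) (j := l + 1) h
    push_cast at h1
    rw [h1, centralShift_of_le h.le]
    obtain ⟨k, rfl⟩ : ∃ k, n = l + 1 + k := ⟨n - (l + 1), by omega⟩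
    rw [show l + 1 + k - (l + 1) = k by omega, show l + 1 + k - l = k + 1 by omega]
    have := Nat.choose_succ_right_eq (2 * (l + 1 + k)) k
    rw [show 2 * (l + 1 + k) - k = 2 * l + 2 + k by omega] at this
    have h2 : (((2 * (l + 1 + k)).choose (k + 1) : ℝ)) * (k + 1)
        = ((2 * (l + 1 + k)).choose k : ℝ) * (2 * l + 2 + k) := by exact_mod_cast this
    push_cast
    linear_combination -h2
  · rw [centralShift_of_lt (by omega)]; ring
  · rw [centralShift_of_lt (by omega), centralShift_of_lt (by omega)]; ring

theorem levSeries_zero_eq : levSeries 0 = 1 + X * (levSeries 0 + levSeries 1) := by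
  have hC := treeSeries_eq
  simp only [levSeries]
  linear_combination (1 + X * treeSeries) * hC

theorem levSeries_succ_eq (p : ℕ) :
    levSeries (p + 1) = X * (levSeries p + 2 * levSeries (p + 1) + levSeries (p + 2)) := by
  have hC := treeSeries_eq
  simp only [levSeries]
  linear_combination (X ^ (p + 1) * treeSeries ^ (2 * p + 1)
    * (treeSeries + 1 + X * treeSeries ^ 2)) * hC

/-- Both sides obey the same three-term recurrence in `n`; at the boundary `p = 0` the reflection
`centralShift_neg_one` makes them agree. -/
theorem coeff_levSeries (n p : ℕ) :
    coeff n (levSeries p) = centralShift n p - centralShift n (p + 1) := by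
  induction n generalizing p with
  | zero =>
    cases p with
    | zero => rw [levSeries_zero_eq]; simp [centralShift, binom]
    | succ p =>
      rw [levSeries_succ_eq, centralShift_of_lt (by push_cast; omega),
        centralShift_of_lt (by push_cast; omega)]; simp
  | succ n ih =>
    have h2 : ∀ F : ℝ⟦X⟧, coeff n (2 * F) = 2 * coeff n F := fun F => by
      rw [two_mul, map_add, two_mul]
    cases p with
    | zero =>
      have hone : coeff (n + 1) (1 : ℝ⟦X⟧) = 0 := by rw [coeff_one, if_neg n.succ_ne_zero]
      rw [levSeries_zero_eq, map_add, coeff_succ_X_mul, map_add, ih, ih, centralShift_succ,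
        centralShift_succ, hone]
      have := centralShift_neg_one n
      norm_num at this ⊢
      linear_combination -this
    | succ p =>
      rw [levSeries_succ_eq, coeff_succ_X_mul, map_add, map_add, h2, ih, ih, ih,
        centralShift_succ, centralShift_succ]
      push_cast
      rw [show (p : ℤ) + 1 - 1 = p by ring, show (p : ℤ) + 1 + 1 - 1 = p + 1 by ring,
        show (p : ℤ) + 2 = p + 1 + 1 by ring]
      ring

theorem sum_levCard_mul {k l : ℕ} (h : k ≤ l) (n : ℕ) :
    ∑ T ∈ treesWithEdges n, (T.levCard k : ℝ) * T.levCard l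
      = centralShift n l + centralShift n (l + 1) - 2 * centralShift n (k + l + 1) := by
  obtain ⟨m, rfl⟩ := Nat.exists_eq_add_of_le h
  have h1 := congrArg (coeff n) (genFun_levCard_mul k m)
  rw [genFun, coeff_mk] at h1
  rw [h1, two_mul, map_add, map_add, ← two_mul, map_sum, coeff_levSeries]
  have h2 := Finset.sum_range_sub' (fun p : ℕ => centralShift n (k + m + 1 + p)) k
  have h3 : ∀ p, coeff n (levSeries (k + m + 1 + p))
      = centralShift n (k + m + 1 + (p : ℕ)) - centralShift n (k + m + 1 + (p + 1 : ℕ)) := by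
    intro p; rw [coeff_levSeries]; push_cast; rfl
  rw [Finset.sum_congr rfl fun p _ => h3 p, h2]
  push_cast
  rw [add_zero, show (k : ℤ) + m + 1 + k = k + (k + m) + 1 by ring]
  ring

theorem sum_levCard (n l : ℕ) :
    ∑ T ∈ treesWithEdges n, (T.levCard l : ℝ) = centralShift n l - centralShift n (l + 1) := by
  rw [← coeff_levSeries, ← genFun_levCard, genFun, coeff_mk]

-- The depth-first total.

/-- The generating function of the binomial coefficients `2n` over `n - l`. -/
noncomputable def shiftSeries (l : ℕ) : ℝ⟦X⟧ := PowerSeries.mk fun n => centralShift n l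

theorem shiftSeries_sub (l : ℕ) : shiftSeries l - shiftSeries (l + 1) = levSeries l := by
  ext n; simp [shiftSeries, coeff_levSeries]

/-- The difference of the two sides does not depend on `l`, because `levSeries` is geometric with
ratio `X * treeSeries ^ 2`. Moving the index beyond `n` kills its coefficient at `n`. -/
theorem shiftSeries_succ (l : ℕ) :
    shiftSeries (l + 1) = X * treeSeries ^ 2 * shiftSeries l := by
  have h1 : ∀ m, shiftSeries (l + 1) - X * treeSeries ^ 2 * shiftSeries l
      = shiftSeries (l + m + 1) - X * treeSeries ^ 2 * shiftSeries (l + m) := by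
    intro m
    induction m with
    | zero => rfl
    | succ m ih =>
      rw [ih]
      have h2 := shiftSeries_sub (l + m)
      have h3 := shiftSeries_sub (l + m + 1)
      have h4 : levSeries (l + m + 1) = X * treeSeries ^ 2 * levSeries (l + m) := by
        simp only [levSeries]; ring
      rw [show l + (m + 1) = l + m + 1 by ring]
      linear_combination h3 - X * treeSeries ^ 2 * h2 + h4
  rw [← sub_eq_zero]
  ext n
  rw [h1 (n + 1), map_sub, coeff_mul, Finset.sum_eq_zero]
  · simp [shiftSeries, centralShift_of_lt (n := n) (j := l + (n + 1) + 1) (by omega)]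
  · intro p hp
    have := Finset.HasAntidiagonal.mem_antidiagonal.1 hp
    rw [shiftSeries, coeff_mk, centralShift_of_lt (by push_cast; omega), mul_zero]

theorem genFun_numEdges_succ : genFun (fun T => (T.numEdges : ℝ) + 1) = shiftSeries 0 := by
  ext n
  rw [genFun, shiftSeries, coeff_mk, coeff_mk]
  have h1 : ∑ T ∈ treesWithEdges n, ((T.numEdges : ℝ) + 1)
      = (n + 1) * ∑ T ∈ treesWithEdges n, (T.levCard 0 : ℝ) := by
    rw [Finset.mul_sum]
    refine Finset.sum_congr rfl fun T hT => ?_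
    rw [mem_treesWithEdges.1 hT, levCard_zero]; simp
  rw [h1, sum_levCard]
  have := centralShift_step n 0
  push_cast at this ⊢
  linear_combination -this

theorem genFun_dfsTotal (l : ℕ) :
    genFun (fun T => (T.dfsTotal l : ℝ)) = (l : ℝ⟦X⟧) * shiftSeries l := by
  induction l with
  | zero => ext n; simp [dfsTotal_zero, genFun]
  | succ l ih =>
    have h := genFun_eq fun T => (T.dfsTotal (l + 1) : ℝ)
    have e : ∀ t T : OrderedTree, ((cons t T).dfsTotal (l + 1) : ℝ)
        = ((t.dfsTotal l : ℝ) + t.levCard l + ((t.numEdges : ℝ) + 1) * T.levCard (l + 1))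
          + T.dfsTotal (l + 1) := by
      intro t T; rw [dfsTotal_cons]; push_cast; ring
    simp only [e] at h
    rw [genFunPair_add, genFunPair_add, genFunPair_add, genFunPair_left fun t => (t.dfsTotal l : ℝ),
      genFunPair_left fun t => (t.levCard l : ℝ), genFunPair_right fun T => (T.dfsTotal (l + 1) : ℝ),
      genFunPair_mul (fun t => (t.numEdges : ℝ) + 1), genFun_numEdges_succ, ih, dfsTotal_leaf,
      Nat.cast_zero, map_zero, zero_add, genFun_levCard, genFun_levCard] at h
    rw [eq_of_eq_X_mul h, shiftSeries_succ l, ← shiftSeries_sub l]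
    have hE : ∀ l, shiftSeries l = (X * treeSeries ^ 2) ^ l * shiftSeries 0 := by
      intro l
      induction l with
      | zero => simp
      | succ l ih => rw [shiftSeries_succ, ih]; ring
    -- This turns the contribution of `t.numEdges + 1` into `treeSeries * shiftSeries (l + 1)`,
    -- which cancels the negative part of `levSeries l` and leaves `l + 1` copies of `shiftSeries
    -- l`.
    have h0 : levSeries (l + 1) * shiftSeries 0 = treeSeries * shiftSeries (l + 1) := by
      rw [hE (l + 1)]; simp only [levSeries]; ring
    rw [shiftSeries_succ l] at h0 ⊢
    push_cast
    linear_combination X * treeSeries * h0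

end OrderedTree

-- Exact formulas.

section ClosedForms

open OrderedTree

theorem totalD_eq (n l : ℕ) : (totalD n l : ℝ) = l * centralShift n l := by
  have h := congrArg (PowerSeries.coeff n) (genFun_dfsTotal l)
  rw [genFun, PowerSeries.coeff_mk, ← map_natCast (PowerSeries.C (R := ℝ)),
    PowerSeries.coeff_C_mul, shiftSeries, PowerSeries.coeff_mk] at h
  rw [totalD, ← h]
  push_cast [sum_dfsScore]
  rfl

theorem totalB_eq (n l : ℕ) :
    (totalB n l : ℝ) = l * centralShift n l + (l + 1) * centralShift n (l + 1)
      - centralShift n (2 * l + 1) - 2 * ∑ j ∈ Finset.Icc (l + 1) (2 * l), centralShift n j := by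
  -- The `choose 2` term, as `(c ^ 2 - c) / 2`, contributes `centralShift n (l + 1) - centralShift n
  -- (2 * l + 1)`: hence the coefficient `l + 1` and the one subtracted term without a factor 2.
  have h1 : (totalB n l : ℝ)
      = ∑ k ∈ Finset.range l, ∑ T ∈ treesWithEdges n, (T.levCard k : ℝ) * T.levCard l
        + (∑ T ∈ treesWithEdges n, (T.levCard l : ℝ) * T.levCard l
          - ∑ T ∈ treesWithEdges n, (T.levCard l : ℝ)) / 2 := by
    rw [Finset.sum_comm, ← Finset.sum_sub_distrib, Finset.sum_div, ← Finset.sum_add_distrib, totalB]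
    push_cast
    refine Finset.sum_congr rfl fun T _ => ?_
    rw [← Nat.cast_sum, sum_bfsScore, ← Finset.sum_mul]
    push_cast [Nat.cast_choose_two]
    ring
  rw [h1, Finset.sum_congr rfl fun k hk => sum_levCard_mul (Finset.mem_range.1 hk).le n,
    sum_levCard_mul le_rfl, sum_levCard, Finset.sum_sub_distrib, ← Finset.mul_sum,
    Finset.sum_const, Finset.card_range, nsmul_eq_mul]
  have h2 : ∑ j ∈ Finset.Icc (l + 1) (2 * l), centralShift n j
      = ∑ k ∈ Finset.range l, centralShift n (k + l + 1) := by
    rw [← Finset.Ico_add_one_right_eq_Icc, Finset.sum_Ico_eq_sum_range]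
    rw [show 2 * l + 1 - (l + 1) = l by omega]
    refine Finset.sum_congr rfl fun k _ => ?_
    push_cast; congr 1; ring
  rw [h2, show (l : ℤ) + l + 1 = 2 * l + 1 by ring]
  ring

theorem mul_centralShift_add (n l : ℕ) :
    (l : ℝ) * centralShift n l + (l + 1) * centralShift n (l + 1)
      = n * (2 * l + 1) / (n + l + 1) * centralShift n l := by
  have h := centralShift_step n l
  have h0 : (n : ℝ) + l + 1 ≠ 0 := by positivity
  field_simp
  linear_combination ((l : ℝ) + 1) * h

end ClosedForms

-- Gaussian approximation of the binomial coefficients.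

section Asymptotic

open OrderedTree Real

theorem one_sub_div_one_add_le_exp {x : ℝ} (h0 : 0 ≤ x) (h1 : x ≤ 1) :
    (1 - x) / (1 + x) ≤ exp (-(2 * x)) := by
  rcases h1.lt_or_eq with h1 | rfl
  -- The series of `log (1 + x) - log (1 - x)` has nonnegative terms and starts with `2 * x`.
  · have h := Real.hasSum_log_sub_log_of_abs_lt_one (abs_lt.2 ⟨by linarith, h1⟩)
    have h2 := sum_le_hasSum {0} (fun i _ => by positivity) h
    simp only [Finset.sum_singleton] at h2
    norm_num at h2
    have hx : 0 < 1 - x := by linarith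
    rw [← Real.log_le_iff_le_exp (by positivity), Real.log_div hx.ne' (by positivity)]
    linarith
  · simp; positivity

theorem exp_mul_le_one_sub_div_one_add {x : ℝ} (h0 : 0 ≤ x) (h1 : x ≤ 1) :
    exp (-(2 * x)) * (1 - 2 * x ^ 3) ≤ (1 - x) / (1 + x) := by
  have h := Real.quadratic_le_exp_of_nonneg (x := 2 * x) (by positivity)
  rw [exp_neg, inv_mul_eq_div, div_le_div_iff₀ (exp_pos _) (by positivity)]
  -- `(1 - x) * (1 + 2 * x + 2 * x ^ 2) = 1 + x - 2 * x ^ 3`, which is at least `(1 - 2 * x ^ 3) *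
  -- (1 + x)`.
  nlinarith [mul_le_mul_of_nonneg_left h (sub_nonneg.2 h1), pow_nonneg h0 4]

/-- The proportion of the binomial coefficient `2n` over `n - j` in `4 ^ n`. -/
noncomputable def walkProb (n j : ℕ) : ℝ := centralShift n j / 4 ^ n

theorem walkProb_nonneg (n j : ℕ) : 0 ≤ walkProb n j := by
  rw [walkProb, centralShift]; positivity

theorem walkProb_of_lt {n j : ℕ} (h : n < j) : walkProb n j = 0 := by
  rw [walkProb, centralShift_of_lt (by omega), zero_div]

theorem walkProb_succ (n j : ℕ) :
    walkProb n (j + 1) = walkProb n j * ((1 - (2 * j + 1) / (2 * n + 1)) /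
      (1 + (2 * j + 1) / (2 * n + 1))) := by
  have h := centralShift_step n j
  have h1 : (n : ℝ) + j + 1 ≠ 0 := by positivity
  have h2 : (1 : ℝ) + (2 * j + 1) / (2 * n + 1) ≠ 0 := by positivity
  have h3 : (1 - (2 * j + 1) / (2 * n + 1)) / (1 + (2 * j + 1) / (2 * n + 1))
      = ((n : ℝ) - j) / (n + j + 1) := by
    rw [div_eq_div_iff h2 h1]; field_simp; ring
  rw [h3, walkProb, walkProb]
  push_cast
  field_simp
  linear_combination h

/-- The exponents add up by `∑ i < j, (2 * i + 1) = j ^ 2`; this is where `n + 1 / 2` comes from. -/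
theorem walkProb_le (n j : ℕ) :
    walkProb n j ≤ walkProb n 0 * exp (-(j ^ 2 / (n + 1 / 2))) := by
  induction j with
  | zero => simp
  | succ j ih =>
    rcases le_or_gt (j + 1) n with h | h
    · have hj : (j : ℝ) + 1 ≤ n := by exact_mod_cast h
      have e : exp (-(((j + 1 : ℕ) : ℝ) ^ 2 / (n + 1 / 2)))
          = exp (-((j : ℝ) ^ 2 / (n + 1 / 2))) * exp (-(2 * ((2 * j + 1) / (2 * n + 1)))) := by
        rw [← exp_add]; congr 1; push_cast; field_simp; ring
      have hx : ((2 * j + 1) / (2 * n + 1) : ℝ) ≤ 1 := by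
        rw [div_le_one (by positivity)]; linarith
      rw [walkProb_succ, e, ← mul_assoc]
      refine mul_le_mul ih (one_sub_div_one_add_le_exp (by positivity) hx) ?_ ?_
      · exact div_nonneg (sub_nonneg.2 hx) (by positivity)
      · exact mul_nonneg (walkProb_nonneg _ _) (exp_pos _).le
    · rw [walkProb_of_lt h]; exact mul_nonneg (walkProb_nonneg _ _) (exp_pos _).le

/-- The relative losses `2 * x ^ 3`, with `x ≤ (i + 1) / n` at step `i`, sum to at most `2 * j ^ 4 /
n ^ 3`. -/
theorem le_walkProb {n j : ℕ} (hn : 1 ≤ n) (h : j ≤ n) :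
    walkProb n 0 * exp (-(j ^ 2 / (n + 1 / 2))) * (1 - 2 * j ^ 4 / n ^ 3) ≤ walkProb n j := by
  have hn0 : (0 : ℝ) < n := by exact_mod_cast hn
  induction j with
  | zero => simp
  | succ j ih =>
    have hj : (j : ℝ) + 1 ≤ n := by exact_mod_cast h
    have e : exp (-(((j + 1 : ℕ) : ℝ) ^ 2 / (n + 1 / 2)))
        = exp (-((j : ℝ) ^ 2 / (n + 1 / 2))) * exp (-(2 * ((2 * j + 1) / (2 * n + 1)))) := by
      rw [← exp_add]; congr 1; push_cast; field_simp; ring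
    set x : ℝ := (2 * j + 1) / (2 * n + 1) with hxdef
    have hx0 : 0 ≤ x := by positivity
    have hx : x ≤ 1 := by rw [hxdef, div_le_one (by positivity)]; linarith
    have hxj : x ≤ (j + 1) / n := by
      rw [hxdef, div_le_div_iff₀ (by positivity) hn0]; nlinarith
    have hx3 : x ^ 3 ≤ (j + 1) ^ 3 / n ^ 3 := by
      rw [← div_pow]; exact pow_le_pow_left₀ hx0 hxj 3
    have hpos : 0 ≤ walkProb n 0 * exp (-((j : ℝ) ^ 2 / (n + 1 / 2))) * exp (-(2 * x)) :=
      mul_nonneg (mul_nonneg (walkProb_nonneg _ _) (exp_pos _).le) (exp_pos _).le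
    rcases le_or_gt 1 (2 * ((j + 1 : ℕ) : ℝ) ^ 4 / n ^ 3) with hb | hb
    · exact (mul_nonpos_of_nonneg_of_nonpos (mul_nonneg (walkProb_nonneg _ _) (exp_pos _).le)
        (sub_nonpos.2 hb)).trans (walkProb_nonneg _ _)
    have hadd : 2 * (j : ℝ) ^ 4 / n ^ 3 + 2 * ((j + 1) ^ 3 / n ^ 3)
        ≤ 2 * ((j + 1 : ℕ) : ℝ) ^ 4 / n ^ 3 := by
      rw [← mul_div_assoc, ← add_div]
      gcongr
      push_cast
      have : (j : ℝ) * j ^ 3 ≤ j * (j + 1) ^ 3 := by gcongr; linarith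
      nlinarith
    have hS0 : 0 ≤ 2 * (j : ℝ) ^ 4 / n ^ 3 := by positivity
    have hx30 : 0 ≤ x ^ 3 := by positivity
    have ih := ih (by omega)
    rw [walkProb_succ, e]
    calc walkProb n 0 * (exp (-((j : ℝ) ^ 2 / (n + 1 / 2))) * exp (-(2 * x)))
          * (1 - 2 * ((j + 1 : ℕ) : ℝ) ^ 4 / n ^ 3)
        = walkProb n 0 * exp (-((j : ℝ) ^ 2 / (n + 1 / 2))) * exp (-(2 * x))
          * (1 - 2 * ((j + 1 : ℕ) : ℝ) ^ 4 / n ^ 3) := by ring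
      _ ≤ walkProb n 0 * exp (-((j : ℝ) ^ 2 / (n + 1 / 2))) * exp (-(2 * x))
          * ((1 - 2 * (j : ℝ) ^ 4 / n ^ 3) * (1 - 2 * x ^ 3)) := by
        refine mul_le_mul_of_nonneg_left ?_ hpos
        nlinarith [mul_nonneg hS0 hx30]
      _ = (walkProb n 0 * exp (-((j : ℝ) ^ 2 / (n + 1 / 2))) * (1 - 2 * (j : ℝ) ^ 4 / n ^ 3))
          * (exp (-(2 * x)) * (1 - 2 * x ^ 3)) := by ring
      _ ≤ walkProb n j * ((1 - x) / (1 + x)) := by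
        refine mul_le_mul ih (exp_mul_le_one_sub_div_one_add hx0 hx) ?_ (walkProb_nonneg _ _)
        refine mul_nonneg (exp_pos _).le ?_
        linarith

theorem walkProb_zero_sq_mul (n : ℕ) : walkProb n 0 ^ 2 * ((2 * n + 1) * Wallis.W n) = 1 := by
  have h1 : walkProb n 0 = ((2 * n).factorial : ℝ) / (n.factorial ^ 2 * 4 ^ n) := by
    have h := centralShift_of_le (Nat.zero_le n)
    rw [Nat.sub_zero, ← Nat.centralBinom_eq_two_mul_choose] at h
    rw [walkProb, h, Nat.centralBinom_eq_two_mul_choose, Nat.cast_choose ℝ (by omega),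
      show 2 * n - n = n by omega]
    field_simp
  rw [h1, Wallis.W_eq_factorial_ratio, show (2 : ℝ) ^ (4 * n) = (4 ^ n) ^ 2 by
    rw [← pow_mul, mul_comm n 2, show 4 * n = 2 * (2 * n) by ring, pow_mul 2 2]; norm_num]
  field_simp

theorem walkProb_zero_sq_le {n : ℕ} (hn : 1 ≤ n) : walkProb n 0 ^ 2 ≤ 1 / (π * n) := by
  have hn0 : (0 : ℝ) < n := by exact_mod_cast hn
  have h1 := walkProb_zero_sq_mul n
  have h2 := Wallis.le_W n
  rw [le_div_iff₀ (by positivity), ← h1]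
  refine mul_le_mul_of_nonneg_left ?_ (sq_nonneg _)
  refine le_trans ?_ (mul_le_mul_of_nonneg_left h2 (by positivity))
  rw [div_mul_div_comm, mul_div_assoc', le_div_iff₀ (by positivity)]
  nlinarith [pi_pos]

theorem le_walkProb_zero_sq (n : ℕ) : 1 / (π * (n + 1 / 2)) ≤ walkProb n 0 ^ 2 := by
  have h1 := walkProb_zero_sq_mul n
  have h2 := Wallis.W_le n
  rw [div_le_iff₀ (by positivity)]
  refine h1.symm.le.trans (mul_le_mul_of_nonneg_left ?_ (sq_nonneg _))
  refine (mul_le_mul_of_nonneg_left h2 (by positivity)).trans (le_of_eq ?_)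
  ring

theorem walkProb_zero_le {n : ℕ} (hn : 1 ≤ n) : walkProb n 0 ≤ 1 / √(π * n) := by
  have := Real.le_sqrt_of_sq_le (walkProb_zero_sq_le hn)
  rwa [Real.sqrt_div zero_le_one, Real.sqrt_one] at this

theorem inv_sqrt_pi_mul_le {n : ℕ} (hn : 1 ≤ n) : 1 / √(π * n) ≤ 1 / √n := by
  have hn0 : (0 : ℝ) < n := by exact_mod_cast hn
  have : (1 : ℝ) ≤ π := by linarith [pi_gt_three]
  gcongr
  nlinarith

theorem sub_walkProb_zero_le {n : ℕ} (hn : 1 ≤ n) :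
    1 / √(π * n) - walkProb n 0 ≤ 1 / √(π * n) / n := by
  have hn0 : (0 : ℝ) < n := by exact_mod_cast hn
  set g := 1 / √(π * n) with hg
  have hg0 : 0 < g := by positivity
  have hg2 : g ^ 2 = 1 / (π * n) := by rw [hg, div_pow, sq_sqrt (by positivity), one_pow]
  have h1 := le_walkProb_zero_sq n
  have h2 : g ^ 2 - g ^ 2 / n ≤ 1 / (π * (n + 1 / 2)) := by
    rw [hg2, div_div, div_sub_div _ _ (by positivity) (by positivity),
      div_le_div_iff₀ (by positivity) (by positivity)]
    have h3 : 0 < π := pi_pos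
    ring_nf
    nlinarith [mul_pos (pow_pos h3 2) hn0, mul_pos (pow_pos h3 2) (pow_pos hn0 2)]
  have h3 := walkProb_nonneg n 0
  by_contra! hc
  have h4 : walkProb n 0 * walkProb n 0 ≤ walkProb n 0 * (g - g / n) :=
    mul_le_mul_of_nonneg_left (by linarith) h3
  have h5 : 0 < g - g / n := by linarith
  have h6 : walkProb n 0 * (g - g / n) < g * (g - g / n) :=
    mul_lt_mul_of_pos_right (by have : 0 < g / n := by positivity
                                linarith) h5
  have h7 : g * (g - g / n) = g ^ 2 - g ^ 2 / n := by ring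
  nlinarith

/-- A polynomial times a decaying exponential is bounded. -/
theorem cube_mul_exp_le {u : ℝ} (hu : 0 ≤ u) : (1 + u) ^ 3 * exp (-(u / 2)) ≤ 216 := by
  -- Cubing `(1 + u) / 6 ≤ exp (u / 6)` gives the constant `6 ^ 3 = 216`.
  have h := Real.add_one_le_exp (u / 6)
  have h2 : ((1 + u) / 6) ^ 3 ≤ exp (u / 6) ^ 3 :=
    pow_le_pow_left₀ (by positivity) (by linarith) 3
  rw [← exp_nat_mul, show ((3 : ℕ) : ℝ) * (u / 6) = u / 2 by push_cast; ring] at h2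
  rw [exp_neg, ← div_eq_mul_inv, div_le_iff₀ (exp_pos _)]
  linarith

/-- The bell curve that approximates `walkProb n`. -/
noncomputable def bell (n : ℕ) (x : ℝ) : ℝ := 1 / √(π * n) * exp (-(x ^ 2 / n))

theorem exp_shifted_le {n : ℕ} (hn : 1 ≤ n) (j : ℕ) :
    exp (-((j : ℝ) ^ 2 / (n + 1 / 2))) ≤ exp (-((j : ℝ) ^ 2 / n / 2)) := by
  have hn0 : (1 : ℝ) ≤ n := by exact_mod_cast hn
  rw [exp_le_exp, neg_le_neg_iff, div_div]
  gcongr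
  linarith

theorem walkProb_le_exp {n : ℕ} (hn : 1 ≤ n) (j : ℕ) :
    walkProb n j ≤ 1 / √n * exp (-((j : ℝ) ^ 2 / n / 2)) :=
  (walkProb_le n j).trans <| mul_le_mul ((walkProb_zero_le hn).trans (inv_sqrt_pi_mul_le hn))
    (exp_shifted_le hn j) (exp_pos _).le (by positivity)

theorem abs_walkProb_sub_bell_le {n : ℕ} (hn : 1 ≤ n) (j : ℕ) :
    |walkProb n j - bell n j| ≤ 432 / (√n * (n + j ^ 2)) := by
  have hn0 : (0 : ℝ) < n := by exact_mod_cast hn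
  have hn1 : (1 : ℝ) ≤ n := by exact_mod_cast hn
  set g := 1 / √(π * n) with hg
  set u : ℝ := (j : ℝ) ^ 2 / n with hu
  set E := exp (-((j : ℝ) ^ 2 / (n + 1 / 2))) with hE
  have hu0 : 0 ≤ u := by positivity
  have hg0 : 0 < g := by positivity
  have hE0 : 0 < E := exp_pos _
  have hw : (j : ℝ) ^ 2 / (n + 1 / 2) ≤ u := by rw [hu]; gcongr; linarith
  have hw2 : u - u / n ≤ (j : ℝ) ^ 2 / (n + 1 / 2) := by
    rw [hu, div_div, div_sub_div _ _ (by positivity) (by positivity),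
      div_le_div_iff₀ (by positivity) (by positivity)]
    have : 0 ≤ (j : ℝ) ^ 2 * n := by positivity
    nlinarith
  have hb : bell n j = g * exp (-u) := rfl
  have heE : exp (-u) ≤ E := by rw [hE, exp_le_exp]; linarith
  have hEe : E - exp (-u) ≤ E * (u / n) := by
    have h1 : exp (-u) = E * exp (-(u - (j : ℝ) ^ 2 / (n + 1 / 2))) := by
      rw [hE, ← exp_add]; congr 1; ring
    have h2 := Real.add_one_le_exp (-(u - (j : ℝ) ^ 2 / (n + 1 / 2)))
    rw [h1]
    nlinarith
  -- Three errors of relative size `1 / n`: `1` from the central value, `u` from replacing `n + 1 /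
  -- 2` by `n`, and `2 * u ^ 2` from `le_walkProb`.
  have hmid : |walkProb n j - bell n j| ≤ g * E / n * (1 + u + 2 * u ^ 2) := by
    rw [hb, abs_le]
    constructor
    · have hgE : g * exp (-u) ≤ g * E := mul_le_mul_of_nonneg_left heE hg0.le
      rcases le_or_gt j n with hj | hj
      · have h1 := le_walkProb hn hj
        rw [← hE, show 2 * (j : ℝ) ^ 4 / n ^ 3 = 2 * u ^ 2 / n by rw [hu]; field_simp] at h1
        have h2 := mul_le_mul_of_nonneg_right (sub_walkProb_zero_le hn) hE0.le
        have h3 : walkProb n 0 * (E * (2 * u ^ 2 / n)) ≤ g * (E * (2 * u ^ 2 / n)) :=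
          mul_le_mul_of_nonneg_right (walkProb_zero_le hn) (by positivity)
        have h4 : 0 ≤ g * E / n * u := by positivity
        have h5 : g * E / n * (1 + u + 2 * u ^ 2)
          = g / n * E + g * E / n * u + g * (E * (2 * u ^ 2 / n)) := by ring
        rw [h5]
        rw [← hg] at h2
        linarith
      -- Beyond `n` the lower bound is unavailable, but the error term with `u` alone already
      -- exceeds the bell curve.
      · have h1 : 1 ≤ u / n := by
          have : (n : ℝ) ≤ j := by exact_mod_cast hj.le
          rw [hu, div_div, le_div_iff₀ (by positivity)]; nlinarith
        have h2 : g * E ≤ g * E * (u / n) := le_mul_of_one_le_right (by positivity) h1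
        have h3 : 0 ≤ g * E / n * (1 + 2 * u ^ 2) := by positivity
        have h4 := walkProb_nonneg n j
        have h5 : g * E / n * (1 + u + 2 * u ^ 2)
          = g * E * (u / n) + g * E / n * (1 + 2 * u ^ 2) := by ring
        linarith
    · have h1 := walkProb_le n j
      have h2 := mul_le_mul_of_nonneg_right (walkProb_zero_le hn) hE0.le
      have h3 := mul_le_mul_of_nonneg_left hEe hg0.le
      have h4 : 0 ≤ g * E / n * (1 + 2 * u ^ 2) := by positivity
      have h5 : g * E / n * (1 + u + 2 * u ^ 2)
          = g * (E * (u / n)) + g * E / n * (1 + 2 * u ^ 2) := by ring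
      rw [← hE] at h1
      rw [← hg] at h2
      linarith
  refine hmid.trans ?_
  have hgn : g ≤ 1 / √n := inv_sqrt_pi_mul_le hn
  have hK : E * ((1 + u) * (1 + u + 2 * u ^ 2)) ≤ 432 := by
    have h1 := cube_mul_exp_le hu0
    have h2 : (1 + u) * (1 + u + 2 * u ^ 2) ≤ 2 * (1 + u) ^ 3 := by nlinarith [pow_nonneg hu0 2]
    have h3 : E * ((1 + u) * (1 + u + 2 * u ^ 2)) ≤ exp (-(u / 2)) * (2 * (1 + u) ^ 3) :=
      mul_le_mul (exp_shifted_le hn j) h2 (by positivity) (exp_pos _).le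
    linarith
  have hnu : (n : ℝ) + j ^ 2 = n * (1 + u) := by rw [hu]; field_simp
  rw [hnu, le_div_iff₀ (by positivity)]
  calc g * E / n * (1 + u + 2 * u ^ 2) * (√n * (n * (1 + u)))
      = (g * √n) * (E * ((1 + u) * (1 + u + 2 * u ^ 2))) := by field_simp
    _ ≤ 1 * 432 := by
      refine mul_le_mul ?_ hK (by positivity) zero_le_one
      rwa [← le_div_iff₀ (by positivity)]
    _ = 432 := one_mul _

-- Comparing the sum with the normal integral.

theorem antitoneOn_bell (n : ℕ) : AntitoneOn (bell n) (Set.Ici 0) := by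
  intro x hx y hy hxy
  have hx : 0 ≤ x := hx
  unfold bell
  gcongr

theorem bell_le {n : ℕ} (hn : 1 ≤ n) (x : ℝ) : bell n x ≤ 1 / √n := by
  refine (mul_le_of_le_one_right (by positivity) ?_).trans (inv_sqrt_pi_mul_le hn)
  exact exp_le_one_iff.2 (neg_nonpos.2 (by positivity))

theorem bell_nonneg (n : ℕ) (x : ℝ) : 0 ≤ bell n x := by unfold bell; positivity

theorem stdNormalCDF_sub (a b : ℝ) :
    stdNormalCDF b - stdNormalCDF a = 1 / √(2 * π) * ∫ x in a..b, exp (-x ^ 2 / 2) := by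
  have hint : MeasureTheory.Integrable fun x : ℝ => exp (-x ^ 2 / 2) := by
    have := integrable_exp_neg_mul_sq (b := 1 / 2) (by norm_num)
    refine this.congr (Filter.Eventually.of_forall fun x => ?_)
    simp only; congr 1; ring
  rw [stdNormalCDF, stdNormalCDF, ← mul_sub,
    intervalIntegral.integral_Iic_sub_Iic hint.integrableOn hint.integrableOn]

theorem stdNormalCDF_sub_eq_integral_bell {n : ℕ} (hn : 1 ≤ n) (a b : ℝ) :
    stdNormalCDF (b / √n * √2) - stdNormalCDF (a / √n * √2) = ∫ x in a..b, bell n x := by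
  have hn0 : (0 : ℝ) < n := by exact_mod_cast hn
  have hc : √2 / √n ≠ 0 := by positivity
  have h := intervalIntegral.integral_comp_mul_left (a := a) (b := b)
    (fun x : ℝ => exp (-x ^ 2 / 2)) hc
  have h1 : ∀ x : ℝ, exp (-(√2 / √n * x) ^ 2 / 2) = exp (-(x ^ 2 / n)) := by
    intro x
    congr 1
    rw [mul_pow, div_pow, sq_sqrt zero_le_two, sq_sqrt hn0.le]; ring
  simp only [h1, smul_eq_mul] at h
  rw [stdNormalCDF_sub]
  simp only [bell]
  rw [intervalIntegral.integral_const_mul, h, show √2 / √n * a = a / √n * √2 by ring,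
    show √2 / √n * b = b / √n * √2 by ring, ← mul_assoc]
  congr 1
  rw [sqrt_mul zero_le_two, sqrt_mul pi_pos.le]
  field_simp

theorem abs_sum_bell_sub_integral_le {n : ℕ} (hn : 1 ≤ n) (l : ℕ) :
    |∑ j ∈ Finset.Icc (l + 1) (2 * l), bell n j - ∫ x in (l : ℝ)..(2 * l : ℝ), bell n x|
      ≤ 1 / √n := by
  have hanti : AntitoneOn (bell n) (Set.Icc (l : ℝ) ((2 * l : ℕ) : ℝ)) :=
    (antitoneOn_bell n).mono fun x hx => (Nat.cast_nonneg l).trans hx.1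
  have h1 := AntitoneOn.sum_le_integral_Ico (by omega : l ≤ 2 * l) hanti
  have h2 := AntitoneOn.integral_le_sum_Ico (by omega : l ≤ 2 * l) hanti
  have h3 := Finset.sum_Ico_eq_sub (fun j : ℕ => bell n (j + 1 : ℕ)) (by omega : l ≤ 2 * l)
  have h4 : ∑ j ∈ Finset.Ico l (2 * l), bell n (j + 1 : ℕ)
      = ∑ j ∈ Finset.Icc (l + 1) (2 * l), bell n j := by
    rw [← Finset.Ico_add_one_right_eq_Icc]
    exact Finset.sum_Ico_add' (fun j : ℕ => bell n j) l (2 * l) 1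
  have h5 : ∑ j ∈ Finset.Ico l (2 * l), bell n (j + 1 : ℕ) - ∑ j ∈ Finset.Ico l (2 * l), bell n j
      = bell n (2 * l : ℕ) - bell n l := by
    rw [← Finset.sum_sub_distrib]
    exact Finset.sum_Ico_sub (fun j : ℕ => bell n j) (by omega)
  rw [h4] at h1 h5
  push_cast at h1 h2 h5
  have h6 := bell_le hn l
  have h7 := bell_nonneg n (2 * l)
  rw [abs_le]
  constructor <;> linarith [div_nonneg zero_le_one (sqrt_nonneg (n : ℝ))]

/-- There are `l` terms, each at most `432 / (√n * (1 + l ^ 2))` since `j ≥ l` and `n ≥ 1`. -/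
theorem abs_sum_walkProb_sub_sum_bell_le {n : ℕ} (hn : 1 ≤ n) (l : ℕ) :
    |∑ j ∈ Finset.Icc (l + 1) (2 * l), walkProb n j - ∑ j ∈ Finset.Icc (l + 1) (2 * l), bell n j|
      ≤ 432 / √n := by
  have hn0 : (0 : ℝ) < n := by exact_mod_cast hn
  rw [← Finset.sum_sub_distrib]
  refine (Finset.abs_sum_le_sum_abs _ _).trans ?_
  have h : ∀ j ∈ Finset.Icc (l + 1) (2 * l),
      |walkProb n j - bell n j| ≤ 432 / (√n * (1 + l ^ 2)) := by
    intro j hj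
    refine (abs_walkProb_sub_bell_le hn j).trans ?_
    have h1 : (1 : ℝ) ≤ n := by exact_mod_cast hn
    have h2 : (l : ℝ) ≤ j := by exact_mod_cast (by have := (Finset.mem_Icc.1 hj).1; omega : l ≤ j)
    gcongr
  refine (Finset.sum_le_card_nsmul _ _ _ h).trans ?_
  rw [Nat.card_Icc, show 2 * l + 1 - (l + 1) = l by omega, nsmul_eq_mul, mul_div_assoc',
    div_le_div_iff₀ (by positivity) (by positivity)]
  have h3 : (l : ℝ) ≤ 1 + l ^ 2 := by nlinarith [sq_nonneg ((l : ℝ) - 1)]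
  have h4 : (l : ℝ) * (432 * √n) ≤ (1 + l ^ 2) * (432 * √n) :=
    mul_le_mul_of_nonneg_right h3 (by positivity)
  linarith

-- The uniform estimate.

theorem totalB_div (n l : ℕ) :
    (totalB n l : ℝ) / 4 ^ n = n * (2 * l + 1) / (n + l + 1) * walkProb n l
      - walkProb n (2 * l + 1) - 2 * ∑ j ∈ Finset.Icc (l + 1) (2 * l), walkProb n j := by
  rw [totalB_eq, mul_centralShift_add]
  simp only [walkProb, ← Finset.sum_div]
  push_cast
  ring

theorem abs_mul_walkProb_sub_le {n : ℕ} (hn : 1 ≤ n) (l : ℕ) :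
    |(n : ℝ) * (2 * l + 1) / (n + l + 1) * walkProb n l - 2 * l * walkProb n l| ≤ 8 / √n := by
  have hn0 : (0 : ℝ) < n := by exact_mod_cast hn
  set u : ℝ := (l : ℝ) ^ 2 / n with hu
  have hu0 : 0 ≤ u := by positivity
  have hl : (l : ℝ) ≤ l ^ 2 := by exact_mod_cast Nat.le_self_pow two_ne_zero l
  have h1 : |(n : ℝ) * (2 * l + 1) / (n + l + 1) - 2 * l| ≤ 1 + 4 * u := by
    have e : (n : ℝ) * (2 * l + 1) / (n + l + 1) - 2 * l
        = (n - 2 * l ^ 2 - 2 * l) / (n + l + 1) := by field_simp; ring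
    have e2 : 1 + 4 * u = (n + 4 * l ^ 2) / n := by rw [hu]; field_simp
    rw [e, e2, abs_div, abs_of_pos (by positivity : (0 : ℝ) < n + l + 1)]
    refine div_le_div₀ (by positivity) ?_ hn0 (by linarith [(Nat.cast_nonneg l : (0 : ℝ) ≤ l)])
    rw [abs_le]
    constructor <;> nlinarith
  -- `1 + 4 * u ≤ 8 * (1 + u / 2) ≤ 8 * exp (u / 2)`.
  have h2 : (1 + 4 * u) * exp (-(u / 2)) ≤ 8 := by
    rw [exp_neg, ← div_eq_mul_inv, div_le_iff₀ (exp_pos _)]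
    linarith [Real.add_one_le_exp (u / 2)]
  rw [← sub_mul, abs_mul, abs_of_nonneg (walkProb_nonneg n l)]
  calc _ ≤ (1 + 4 * u) * (1 / √n * exp (-(u / 2))) :=
        mul_le_mul h1 (walkProb_le_exp hn l) (walkProb_nonneg _ _) (by positivity)
    _ = (1 + 4 * u) * exp (-(u / 2)) / √n := by ring
    _ ≤ 8 / √n := by gcongr

theorem abs_two_mul_walkProb_sub_bell_le {n : ℕ} (hn : 1 ≤ n) (l : ℕ) :
    |2 * l * walkProb n l - 2 * l * bell n l| ≤ 432 / √n := by
  have hn1 : (1 : ℝ) ≤ n := by exact_mod_cast hn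
  rw [← mul_sub, abs_mul, abs_of_nonneg (by positivity : (0 : ℝ) ≤ 2 * l)]
  refine (mul_le_mul_of_nonneg_left (abs_walkProb_sub_bell_le hn l) (by positivity)).trans ?_
  rw [mul_div_assoc', div_le_div_iff₀ (by positivity) (by positivity)]
  have h : 2 * (l : ℝ) ≤ n + l ^ 2 := by nlinarith [sq_nonneg ((l : ℝ) - 1)]
  have h4 : 2 * (l : ℝ) * (432 * √n) ≤ (n + l ^ 2) * (432 * √n) :=
    mul_le_mul_of_nonneg_right h (by positivity)
  linarith

theorem abs_totalB_div_sub_le {n : ℕ} (hn : 1 ≤ n) (l : ℕ) {s : ℝ} (hs : s = l / √n) :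
    |(totalB n l : ℝ) / 4 ^ n -
        (2 * s / √π * exp (-s ^ 2)
          - 2 * (stdNormalCDF (2 * s * √2) - stdNormalCDF (s * √2)))| ≤ 1307 / √n := by
  have hn0 : (0 : ℝ) < n := by exact_mod_cast hn
  have e1 : 2 * s / √π * exp (-s ^ 2) = 2 * l * bell n l := by
    rw [hs, bell, div_pow, sq_sqrt hn0.le, sqrt_mul pi_pos.le]; field_simp
  have e2 : stdNormalCDF (2 * s * √2) - stdNormalCDF (s * √2)
      = ∫ x in (l : ℝ)..(2 * l : ℝ), bell n x := by
    rw [← stdNormalCDF_sub_eq_integral_bell hn, hs, mul_div_assoc]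
  rw [totalB_div, e1, e2]
  have h1 := abs_le.1 (abs_mul_walkProb_sub_le hn l)
  have h2 := abs_le.1 (abs_two_mul_walkProb_sub_bell_le hn l)
  have h3 := abs_le.1 (abs_sum_walkProb_sub_sum_bell_le hn l)
  have h4 := abs_le.1 (abs_sum_bell_sub_integral_le hn l)
  have h5 := walkProb_nonneg n (2 * l + 1)
  have h6 : walkProb n (2 * l + 1) ≤ 1 / √n := by
    refine (walkProb_le_exp hn _).trans (mul_le_of_le_one_right (by positivity) ?_)
    exact exp_le_one_iff.2 (neg_nonpos.2 (by positivity))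
  -- The constant is `1307 = 8 + 432 + 2 * 432 + 2 * 1 + 1`.
  simp only [div_eq_mul_inv] at h1 h2 h3 h4 h6 ⊢
  rw [abs_le]
  constructor <;> linarith

theorem totalB_div_le {n : ℕ} (hn : 1 ≤ n) (l : ℕ) :
    (totalB n l : ℝ) / 4 ^ n ≤ (2 * l + 1) * exp (-((l : ℝ) ^ 2 / n / 2)) := by
  have hn1 : (1 : ℝ) ≤ n := by exact_mod_cast hn
  have h1 : (n : ℝ) * (2 * l + 1) / (n + l + 1) ≤ 2 * l + 1 := by
    rw [div_le_iff₀ (by positivity)]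
    have h0 : (0 : ℝ) ≤ (2 * l + 1) * (l + 1) := by positivity
    linarith
  have h2 : walkProb n l ≤ exp (-((l : ℝ) ^ 2 / n / 2)) := by
    refine (walkProb_le_exp hn l).trans (mul_le_of_le_one_left (exp_pos _).le ?_)
    rw [div_le_one (by positivity)]
    exact Real.one_le_sqrt.2 hn1
  have h3 := mul_le_mul h1 h2 (walkProb_nonneg _ _) (by positivity)
  have h4 := walkProb_nonneg n (2 * l + 1)
  have h5 : 0 ≤ ∑ j ∈ Finset.Icc (l + 1) (2 * l), walkProb n j :=
    Finset.sum_nonneg fun j _ => walkProb_nonneg n j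
  rw [totalB_div]
  linarith

-- Levels far above `√n`.

section LargeLevel

variable {ε : ℝ} {l : ℕ → ℕ} {s : ℕ → ℝ}

theorem tendsto_natCast_rpow (hε : 0 < ε) : Tendsto (fun n : ℕ => (n : ℝ) ^ ε) atTop atTop :=
  (tendsto_rpow_atTop hε).comp tendsto_natCast_atTop_atTop

theorem eventually_totalB_div_le (hε : 0 < ε) (hs : ∀ n, s n = (l n : ℝ) / √(n : ℝ))
    (hlit : (fun n : ℕ => (n : ℝ) ^ ε) =o[atTop] s) :
    ∀ᶠ n : ℕ in atTop,
      (totalB n (l n) : ℝ) / 4 ^ n ≤ 2 * s n * √(n : ℝ) * exp (-(n : ℝ) ^ (2 * ε)) := by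
  filter_upwards [hlit.def (c := 1 / 2) (by norm_num), eventually_ge_atTop 1,
    (tendsto_natCast_rpow hε).eventually_ge_atTop 1] with n h1 hn hA
  have hn0 : (0 : ℝ) < n := by exact_mod_cast hn
  have hs0 : 0 ≤ s n := by rw [hs]; positivity
  have hA2 : (n : ℝ) ^ (2 * ε) = ((n : ℝ) ^ ε) ^ 2 := by
    rw [mul_comm, rpow_mul hn0.le, rpow_two]
  set A := (n : ℝ) ^ ε
  rw [Real.norm_of_nonneg (by positivity), Real.norm_of_nonneg hs0] at h1
  have hls : (l n : ℝ) = s n * √n := by rw [hs]; field_simp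
  have hu : (l n : ℝ) ^ 2 / n = s n ^ 2 := by
    rw [hls, mul_pow, sq_sqrt hn0.le]; field_simp
  have hl1 : (1 : ℝ) ≤ l n := by
    have : (0 : ℝ) < l n := by
      rw [hls]; exact mul_pos (by linarith) (sqrt_pos.2 hn0)
    exact_mod_cast this
  -- From `s n ≥ 2 * A` the exponent is at most `-2 * A ^ 2`. One factor `exp (-A ^ 2)` is kept; the
  -- other is at most `1 / 2` and absorbs the excess of `2 * l n + 1` over `2 * l n`.
  have hexp : exp (-((l n : ℝ) ^ 2 / n / 2)) ≤ exp (-A ^ 2) * exp (-A ^ 2) := by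
    rw [← exp_add, exp_le_exp, hu]; nlinarith
  have hhalf : exp (-A ^ 2) ≤ 1 / 2 := by
    rw [exp_neg, inv_eq_one_div]
    gcongr
    nlinarith [Real.add_one_le_exp (A ^ 2)]
  have hpos := exp_pos (-A ^ 2)
  refine (totalB_div_le hn (l n)).trans ?_
  rw [hA2, show 2 * s n * √(n : ℝ) = 2 * l n by rw [hls]; ring]
  calc (2 * (l n : ℝ) + 1) * exp (-((l n : ℝ) ^ 2 / n / 2))
      ≤ (2 * (l n : ℝ) + 1) * (exp (-A ^ 2) * (1 / 2)) := by
        refine mul_le_mul_of_nonneg_left (hexp.trans ?_) (by positivity)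
        exact mul_le_mul_of_nonneg_left hhalf hpos.le
    _ ≤ 2 * l n * exp (-A ^ 2) := by nlinarith

theorem isLittleO_exp_neg_rpow (hε : 0 < ε) (hl : ∀ n, l n ≤ n)
    (hs : ∀ n, s n = (l n : ℝ) / √(n : ℝ)) :
    (fun n : ℕ => 2 * s n * √(n : ℝ) * exp (-(n : ℝ) ^ (2 * ε)))
      =o[atTop] (fun n : ℕ => exp (-(n : ℝ) ^ ε)) := by
  -- With `A = n ^ ε`, the prefactor is at most `2 * n = 2 * A ^ (1 / ε)`, and `exp (-A ^ 2) ≤ exp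
  -- (-A) * exp (-A)` once `A ≥ 2`; one factor beats the power.
  have h0 : Tendsto (fun n : ℕ => ((n : ℝ) ^ ε) ^ (1 / ε) * exp (-1 * (n : ℝ) ^ ε)) atTop
      (nhds 0) :=
    (tendsto_rpow_mul_exp_neg_mul_atTop_nhds_zero (1 / ε) 1 one_pos).comp (tendsto_natCast_rpow hε)
  have h1 := ((isLittleO_one_iff ℝ).2 h0).mul_isBigO
    (isBigO_refl (fun n : ℕ => exp (-(n : ℝ) ^ ε)) atTop)
  simp only [one_mul] at h1
  refine IsBigO.trans_isLittleO (IsBigO.of_bound 2 ?_) h1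
  filter_upwards [eventually_ge_atTop 1, (tendsto_natCast_rpow hε).eventually_ge_atTop 2]
    with n hn hA
  have hn0 : (0 : ℝ) < n := by exact_mod_cast hn
  have hA2 : (n : ℝ) ^ (2 * ε) = ((n : ℝ) ^ ε) ^ 2 := by
    rw [mul_comm, rpow_mul hn0.le, rpow_two]
  have hA1 : ((n : ℝ) ^ ε) ^ (1 / ε) = n := by
    rw [← rpow_mul hn0.le, mul_one_div_cancel hε.ne', rpow_one]
  rw [hA1, hA2, show 2 * s n * √(n : ℝ) = 2 * l n by rw [hs]; field_simp]
  set A := (n : ℝ) ^ ε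
  have hln : (l n : ℝ) ≤ n := by exact_mod_cast hl n
  rw [Real.norm_of_nonneg (by positivity), Real.norm_of_nonneg (by positivity), mul_assoc (n : ℝ),
    ← exp_add, ← mul_assoc]
  refine mul_le_mul (by linarith) ?_ (exp_pos _).le (by positivity)
  rw [exp_le_exp]
  nlinarith

end LargeLevel

end Asymptotic

theorem theorem3p1 :
    (∀ n l : ℕ, l ≤ n →
      (totalB n l : ℝ) =
          (n : ℝ) * (2 * (l : ℝ) + 1) / ((n : ℝ) + (l : ℝ) + 1) * (binom (2 * n) ((n : ℤ) - l) : ℝ)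
            - (binom (2 * n) ((n : ℤ) - 2 * l - 1) : ℝ)
            - 2 * ∑ j ∈ Finset.Icc (l + 1) (2 * l), (binom (2 * n) ((n : ℤ) - j) : ℝ) ∧
      (totalB n l : ℝ) =
          (totalD n l : ℝ) + (totalD n (l + 1) : ℝ)
            - (binom (2 * n) ((n : ℤ) - 2 * l - 1) : ℝ)
            - 2 * ∑ j ∈ Finset.Icc (l + 1) (2 * l), (binom (2 * n) ((n : ℤ) - j) : ℝ)) ∧
    (∃ C : ℝ, ∀ n l : ℕ, 1 ≤ n → l ≤ n → ∀ s : ℝ, s = (l : ℝ) / √(n : ℝ) →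
      |(totalB n l : ℝ) / 4 ^ n -
          (2 * s / √Real.pi * Real.exp (-s ^ 2)
            - 2 * (stdNormalCDF (2 * s * √2) - stdNormalCDF (s * √2)))| ≤ C / √(n : ℝ)) ∧
    (∀ ε : ℝ, 0 < ε → ∀ (l : ℕ → ℕ) (s : ℕ → ℝ),
      (∀ n, l n ≤ n) → (∀ n, s n = (l n : ℝ) / √(n : ℝ)) →
      (fun n : ℕ => (n : ℝ) ^ ε) =o[atTop] s →
      (∀ᶠ n : ℕ in atTop,
        (totalB n (l n) : ℝ) / 4 ^ n ≤ 2 * s n * √(n : ℝ) * Real.exp (-(n : ℝ) ^ (2 * ε))) ∧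
      (fun n : ℕ => 2 * s n * √(n : ℝ) * Real.exp (-(n : ℝ) ^ (2 * ε)))
        =o[atTop] (fun n : ℕ => Real.exp (-(n : ℝ) ^ ε)) ∧
      (fun n : ℕ => (totalB n (l n) : ℝ) / 4 ^ n)
        =o[atTop] (fun n : ℕ => Real.exp (-(n : ℝ) ^ ε))) := by
  refine ⟨fun n l _ => ⟨?_, ?_⟩, ⟨1307, fun n l hn _ s hs => abs_totalB_div_sub_le hn l hs⟩,
    fun ε hε l s hl hs hlit => ?_⟩
  · have h := totalB_eq n l
    rw [mul_centralShift_add] at h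
    simp only [OrderedTree.centralShift, sub_add_eq_sub_sub] at h
    exact_mod_cast h
  · have h := totalB_eq n l
    rw [totalD_eq, totalD_eq, h]
    push_cast
    simp only [OrderedTree.centralShift, sub_add_eq_sub_sub]
  · have h1 := eventually_totalB_div_le hε hs hlit
    have h2 := isLittleO_exp_neg_rpow hε hl hs
    refine ⟨h1, h2, IsBigO.trans_isLittleO (IsBigO.of_bound 1 ?_) h2⟩
    filter_upwards [h1] with n h
    rw [one_mul, Real.norm_of_nonneg (by positivity)]
    exact h.trans (Real.le_norm_self _)
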